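/- Let $p$ be a prime. For a group $A$ let $A^{(0)}_p=A$ and $A^{(n+1)}_p=(A^{(n)}_p)^p\,[A^{(n)}_p,A^{(n)}_p]$ be its $p$-derived series, and let $\Phi^{(n)}_p(A)$ be the image of the inclusion-induced map $H_2(A^{(n)}_p;\mathbb Z_p)\to H_2(A;\mathbb Z_p)$, where $\mathbb Z_p=\mathbb Z/p\mathbb Z$. For $n\ge 0$ let $(\mathcal H_p^{CH})^n$ be the class of homomorphisms $f:A\to B$ such that $A$ is finitely generated, $B$ is finitely presented, and $f$ induces an isomorphism on $H_1(-;\mathbb Z_p)$ and an epimorphism $$H_2(A;\mathbb Z_p)/\Phi^{(n-1)}_p(A)\to H_2(B;\mathbb Z_p)/\Phi^{(n-1)}_p(B)$$ (for $n=0$ the condition on $H_2$ is void). Let $(\widetilde{\mathcal H}_p^{CH})^n$ be the larger class obtained by requiring only a monomorphism on $H_1(-;\mathbb Z_p)$. Proposition 4.3. The $p$-derived series is stable, on finitely generated groups, with respect to $\{(\mathcal H_p^{CH})^n\}$, and also with respect to $\{(\widetilde{\mathcal H}_p^{CH})^n\}$. That is, if $\{\mathcal H^n\}$ is either of these two collections,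 then for every $n\ge 0$: 1. $f(A^{(n)}_p)\subseteq B^{(n)}_p$ for every $f:A\to B$ in $\mathcal H^n$; 2. for every finitely generated group $A$, $$\{a\in A \mid \text{there is } f:A\to B \text{ in } \mathcal H^n \text{ with } f(a)\in B^{(n)}_p\}=A^{(n)}_p .$$ -/

import Mathlib

universe u

namespace StableSeries

/-! ## Subgroup functions, series, classes of maps, stability -/

/-- A (normal) subgroup function: it assigns to each group a normal subgroup. -/
structure SubgroupFunction where
  /-- the subgroup assigned to a group -/
  sub : ∀ (A : Type u) [Group A], Subgroup A
  normal : ∀ (A : Type u) [Group A], (sub A).Normal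

/-- A (normal) series: a descending sequence of subgroup functions starting with the whole
group. -/
structure Series where
  /-- the terms of the series -/
  term : ℕ → SubgroupFunction.{u}
  term_zero : ∀ (A : Type u) [Group A], (term 0).sub A = ⊤
  term_succ_le : ∀ (n : ℕ) (A : Type u) [Group A], (term (n + 1)).sub A ≤ (term n).sub A

/-- A collection of group homomorphisms. -/
abbrev MapClass : Type (u + 1) :=
  ∀ ⦃A B : Type u⦄ [Group A] [Group B], (A →* B) → Prop

/-- `Γ` is `H`-invariant: `f (Γ A) ⊆ Γ B` for all `f : A → B` in `H`. -/
def IsInvariant (Γ : SubgroupFunction.{u}) (H : MapClass.{u}) : Prop :=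
  ∀ (A B : Type u) [Group A] [Group B] (f : A →* B), H f → (Γ.sub A).map f ≤ Γ.sub B

/-- The stabilization `Γ_S A = {a ∈ A | ∃ f : A → B in H with f a ∈ Γ B}`. -/
def stabilization (Γ : SubgroupFunction.{u}) (H : MapClass.{u}) (A : Type u) [Group A] : Set A :=
  {a | ∃ (B : Type u) (_ : Group B) (f : A →* B), H f ∧ f a ∈ Γ.sub B}

/-- `Γ` is stable under `H`, relative to the full subcategory of the groups that satisfy `C`:
`Γ` is `H`-invariant and `Γ_S A = Γ A` for every `A` in `C`. -/
def IsStable (C : ∀ (A : Type u) [Group A], Prop) (Γ : SubgroupFunction.{u})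
    (H : MapClass.{u}) : Prop :=
  IsInvariant Γ H ∧
    ∀ (A : Type u) [Group A], C A → stabilization Γ H A = (Γ.sub A : Set A)

/-- A series is stable under a sequence of classes of maps if each term is stable under the
corresponding class. -/
def IsStableSeries (C : ∀ (A : Type u) [Group A], Prop) (Γ : Series.{u})
    (H : ℕ → MapClass.{u}) : Prop :=
  ∀ n : ℕ, IsStable C (Γ.term n) (H n)

/-! ## The `p`-derived series -/

/-- The `p`-derived series `A⁽⁰⁾ = A`, `A⁽ⁿ⁺¹⁾ = (A⁽ⁿ⁾)^p [A⁽ⁿ⁾, A⁽ⁿ⁾]`; here `(A⁽ⁿ⁾)^p` is the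
subgroup generated by the `p`-th powers of elements of `A⁽ⁿ⁾`. -/
def pDerived (p : ℕ) (A : Type u) [Group A] : ℕ → Subgroup A
  | 0 => ⊤
  | n + 1 => Subgroup.closure ((fun x : A => x ^ p) '' (pDerived p A n : Set A)) ⊔
      ⁅pDerived p A n, pDerived p A n⁆

theorem pDerived_succ_le (p : ℕ) (A : Type u) [Group A] (n : ℕ) :
    pDerived p A (n + 1) ≤ pDerived p A n := by
  refine sup_le ?_ (Subgroup.commutator_le_self _)
  rw [Subgroup.closure_le]
  rintro _ ⟨x, hx, rfl⟩
  exact pow_mem hx p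

theorem map_pDerived_le (p : ℕ) {A B : Type u} [Group A] [Group B] (f : A →* B) (n : ℕ) :
    (pDerived p A n).map f ≤ pDerived p B n := by
  induction n with
  | zero => exact le_top
  | succ n ih =>
    rw [pDerived, pDerived, Subgroup.map_sup, Subgroup.map_commutator, MonoidHom.map_closure]
    refine sup_le_sup (Subgroup.closure_mono ?_) (Subgroup.commutator_mono ih ih)
    rintro _ ⟨_, ⟨x, hx, rfl⟩, rfl⟩
    exact ⟨f x, ih ⟨x, hx, rfl⟩, (map_pow f x p).symm⟩

theorem pDerived_normal (p : ℕ) (A : Type u) [Group A] (n : ℕ) : (pDerived p A n).Normal :=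
  ⟨fun x hx g => map_pDerived_le p (MulAut.conj g).toMonoidHom n ⟨x, hx, rfl⟩⟩

/-- The `p`-derived series as a normal series of subgroup functions. -/
def pDerivedSeries (p : ℕ) : Series.{u} where
  term n := ⟨fun A _ => pDerived p A n, fun A _ => pDerived_normal p A n⟩
  term_zero _ _ := rfl
  term_succ_le n A _ := pDerived_succ_le p A n

/-- The homomorphism `A⁽ⁿ⁾ → B⁽ⁿ⁾` induced by `f : A → B` on terms of the `p`-derived series. -/
def pDerivedMap (p : ℕ) {A B : Type u} [Group A] [Group B] (f : A →* B) (n : ℕ) :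
    pDerived p A n →* pDerived p B n :=
  (f.comp (pDerived p A n).subtype).codRestrict _
    fun x => map_pDerived_le p f n ⟨x, x.2, rfl⟩

/-! ## Group homology with coefficients in `ℤ/p` -/

/-- The field `ℤ/p`, moved to the universe of the groups (as Mathlib's functoriality of group
homology requires). -/
abbrev Fp (p : ℕ) : Type u := ULift.{u} (ZMod p)

/-- The group homology `H_i(A; ℤ/p)`, with trivial action on the coefficients. -/
noncomputable abbrev Homology (p : ℕ) (A : Type u) [Group A] (i : ℕ) : ModuleCat.{u} (Fp.{u} p) :=
  groupHomology (Rep.trivial (Fp.{u} p) A (Fp.{u} p)) i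

/-- The linear map `H_i(A; ℤ/p) → H_i(B; ℤ/p)` induced by a homomorphism `f : A → B`. -/
noncomputable def homologyMap (p : ℕ) {A B : Type u} [Group A] [Group B] (f : A →* B) (i : ℕ) :
    Homology p A i →ₗ[Fp.{u} p] Homology p B i :=
  (groupHomology.map (A := Rep.trivial (Fp.{u} p) A (Fp.{u} p))
    (B := Rep.trivial (Fp.{u} p) B (Fp.{u} p)) f
    (CategoryTheory.CategoryStruct.id (Rep.trivial (Fp.{u} p) A (Fp.{u} p))) i).hom

theorem homologyMap_comp (p : ℕ) {A B C : Type u} [Group A] [Group B] [Group C]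
    (g : B →* C) (f : A →* B) (i : ℕ) :
    homologyMap p (g.comp f) i = homologyMap p g i ∘ₗ homologyMap p f i := by
  unfold homologyMap
  rw [← ModuleCat.hom_comp]
  congr 1
  exact groupHomology.map_comp (A := Rep.trivial (Fp.{u} p) A (Fp.{u} p))
    (B := Rep.trivial (Fp.{u} p) B (Fp.{u} p)) (C := Rep.trivial (Fp.{u} p) C (Fp.{u} p)) f g
    (CategoryTheory.CategoryStruct.id _) (CategoryTheory.CategoryStruct.id _) i

/-- `Φ⁽ⁿ⁾(A)`: the image of the inclusion-induced map `H_2(A⁽ⁿ⁾; ℤ/p) → H_2(A; ℤ/p)`. -/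
noncomputable def Phi (p : ℕ) (A : Type u) [Group A] (n : ℕ) :
    Submodule (Fp.{u} p) (Homology p A 2) :=
  LinearMap.range (homologyMap p (pDerived p A n).subtype 2)

theorem Phi_le_comap (p : ℕ) {A B : Type u} [Group A] [Group B] (f : A →* B) (n : ℕ) :
    Phi p A n ≤ (Phi p B n).comap (homologyMap p f 2) := by
  rintro _ ⟨x, rfl⟩
  refine ⟨homologyMap p (pDerivedMap p f n) 2 x, ?_⟩
  have h : (pDerived p B n).subtype.comp (pDerivedMap p f n) =
      f.comp (pDerived p A n).subtype := rfl
  have h2 := congrArg (fun φ => homologyMap p φ 2 x) h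
  simpa only [homologyMap_comp, LinearMap.comp_apply] using h2

/-- The map `H_2(A; ℤ/p) / Φ⁽ⁿ⁾(A) → H_2(B; ℤ/p) / Φ⁽ⁿ⁾(B)` induced by `f : A → B`. -/
noncomputable def homologyTwoQuotientMap (p : ℕ) {A B : Type u} [Group A] [Group B]
    (f : A →* B) (n : ℕ) :
    (Homology p A 2 ⧸ Phi p A n) →ₗ[Fp.{u} p] (Homology p B 2 ⧸ Phi p B n) :=
  (Phi p A n).mapQ (Phi p B n) (homologyMap p f 2) (Phi_le_comap p f n)

/-! ## The classes of maps -/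

/-- The `n`-th class: `f : A → B` with `A` finitely generated, `B` finitely presented, `f` an
isomorphism on `H_1(-; ℤ/p)` and an epimorphism
`H_2(A; ℤ/p) / Φ⁽ⁿ⁻¹⁾(A) → H_2(B; ℤ/p) / Φ⁽ⁿ⁻¹⁾(B)`.
For `n = 0` the truncated `n - 1` is `0`; since `Φ⁽⁰⁾` is all of `H_2`, the last condition is then
vacuous, and the class for `n = 0` is the one for `n = 1`. -/
def chClass (p n : ℕ) : MapClass.{u} := fun A B _ _ f =>
  Group.FG A ∧ Group.IsFinitelyPresented B ∧
    Function.Bijective (homologyMap p f 1) ∧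
    Function.Surjective (homologyTwoQuotientMap p f (n - 1))

/-- The larger `n`-th class, in which the condition on `H_1(-; ℤ/p)` is relaxed to that of being
a monomorphism. -/
def chMonoClass (p n : ℕ) : MapClass.{u} := fun A B _ _ f =>
  Group.FG A ∧ Group.IsFinitelyPresented B ∧
    Function.Injective (homologyMap p f 1) ∧
    Function.Surjective (homologyTwoQuotientMap p f (n - 1))

end StableSeries

/-! Everything is dualised to cohomology over the field `Fp p`. A monomorphism on `H_1` says that
homomorphisms to the field extend along `f`. An epimorphism on `H_2 / Φ⁽ⁿ⁾` says that a class in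
`H²(B)` dying on `A` and on `B⁽ⁿ⁾` is zero (`homologyTwoQuotientMap_surjective_iff`).

The heart is a Stallings-type injectivity of `A / A⁽ᵏ⁾ → B / B⁽ᵏ⁾`, by induction on `k`
(`comap_pDerived_le`). Let `a ∈ A⁽ᵏ⁾` lie outside `A⁽ᵏ⁺¹⁾` with `f a ∈ B⁽ᵏ⁺¹⁾`. Some homomorphism
`A⁽ᵏ⁾ → Fp` is nonzero at `a`; by Shapiro's lemma it comes from a crossed homomorphism `d` on `A`
with values in the functions on `B / B⁽ᵏ⁾`. As `B / B⁽ᵏ⁾` is a finite `p`-group, this module is an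
iterated extension of trivial lines, and the two dual conditions extend `d` to `B` up to a principal
term (`exists_crossedHom_extension`). The extension is additive on `B⁽ᵏ⁾`, so it vanishes at `f a`,
forcing the homomorphism to vanish at `a`.

For the other inclusion any map of the class with source `A` will do, by functoriality of the
series. The identity is unavailable if `A` is not finitely presented; the projection to a finite
quotient `A / A⁽ᵐ⁺¹⁾` serves instead (`chClass_mk'`). -/

namespace StableSeries

open groupHomology Finsupp

/-! ### Explicit chains for `H_1` and `H_2` with trivial coefficients. -/

section Bridge

variable {p : ℕ} {A B : Type u} [Group A] [Group B]

/-- The boundary map from inhomogeneous `2`-chains to `1`-chains, with coefficients in `ℤ/p`. -/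
noncomputable def boundaryTwo (p : ℕ) (A : Type u) [Group A] :
    (A × A →₀ Fp.{u} p) →ₗ[Fp.{u} p] (A →₀ Fp.{u} p) :=
  linearCombination _ fun g => single g.2 1 - single (g.1 * g.2) 1 + single g.1 1

/-- The boundary map from inhomogeneous `3`-chains to `2`-chains, with coefficients in `ℤ/p`. -/
noncomputable def boundaryThree (p : ℕ) (A : Type u) [Group A] :
    (A × A × A →₀ Fp.{u} p) →ₗ[Fp.{u} p] (A × A →₀ Fp.{u} p) :=
  linearCombination _ fun g => single (g.2.1, g.2.2) 1 - single (g.1 * g.2.1, g.2.2) 1 +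
    single (g.1, g.2.1 * g.2.2) 1 - single (g.1, g.2.1) 1

theorem d₂₁_trivial_eq :
    (d₂₁ (Rep.trivial (Fp.{u} p) A (Fp.{u} p))).hom = boundaryTwo p A := by
  refine Finsupp.lhom_ext fun g c => ?_
  refine (d₂₁_single (A := Rep.trivial (Fp.{u} p) A (Fp.{u} p)) g c).trans ?_
  rw [boundaryTwo, linearCombination_single, smul_add, smul_sub]
  simp only [smul_single, smul_eq_mul, mul_one]
  rfl

theorem d₃₂_trivial_eq :
    (d₃₂ (Rep.trivial (Fp.{u} p) A (Fp.{u} p))).hom = boundaryThree p A := by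
  refine Finsupp.lhom_ext fun g c => ?_
  refine (d₃₂_single (A := Rep.trivial (Fp.{u} p) A (Fp.{u} p)) g c).trans ?_
  rw [boundaryThree, linearCombination_single, smul_sub, smul_add, smul_sub]
  simp only [smul_single, smul_eq_mul, mul_one]
  rfl

/-- The projection from `1`-chains (all of which are cycles) to `H_1(A; ℤ/p)`. -/
noncomputable def homologyOneMk (p : ℕ) (A : Type u) [Group A] :
    (A →₀ Fp.{u} p) →ₗ[Fp.{u} p] Homology p A 1 :=
  (H1π (Rep.trivial (Fp.{u} p) A (Fp.{u} p))).hom ∘ₗ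
    LinearMap.codRestrict (cycles₁ (Rep.trivial (Fp.{u} p) A (Fp.{u} p))) LinearMap.id
      fun x => by rw [cycles₁_eq_top_of_isTrivial]; trivial

theorem homologyOneMk_surjective : Function.Surjective (homologyOneMk p A) := by
  intro x
  induction x using H1_induction_on with | @h x =>
  exact ⟨x.1, rfl⟩

theorem homologyOneMk_eq_zero_iff (x : A →₀ Fp.{u} p) :
    homologyOneMk p A x = 0 ↔ x ∈ LinearMap.range (boundaryTwo p A) := by
  rw [← d₂₁_trivial_eq]
  exact H1π_eq_zero_iff (A := Rep.trivial (Fp.{u} p) A (Fp.{u} p)) _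

theorem homologyMap_homologyOneMk (f : A →* B) (x : A →₀ Fp.{u} p) :
    homologyMap p f 1 (homologyOneMk p A x) = homologyOneMk p B (mapDomain f x) := by
  refine (H1π_comp_map_apply (A := Rep.trivial (Fp.{u} p) A (Fp.{u} p))
    (B := Rep.trivial (Fp.{u} p) B (Fp.{u} p)) f _ _).trans ?_
  refine congrArg (H1π (Rep.trivial (Fp.{u} p) B (Fp.{u} p))) (Subtype.ext ?_)
  exact Finsupp.mapRange_id _

/-- The projection from `2`-cycles to `H_2(A; ℤ/p)`. -/
noncomputable def homologyTwoMk (p : ℕ) (A : Type u) [Group A] :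
    LinearMap.ker (boundaryTwo p A) →ₗ[Fp.{u} p] Homology p A 2 :=
  (H2π (Rep.trivial (Fp.{u} p) A (Fp.{u} p))).hom ∘ₗ
    Submodule.inclusion (by rw [cycles₂, d₂₁_trivial_eq])

theorem homologyTwoMk_surjective : Function.Surjective (homologyTwoMk p A) := by
  rw [homologyTwoMk, LinearMap.coe_comp]
  refine Function.Surjective.comp ((ModuleCat.epi_iff_surjective _).1 inferInstance) fun x => ?_
  have hx : x.1 ∈ LinearMap.ker (boundaryTwo p A) := by
    rw [← d₂₁_trivial_eq]
    exact x.2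
  exact ⟨⟨x.1, hx⟩, Subtype.ext rfl⟩

theorem homologyTwoMk_eq_zero_iff (x : LinearMap.ker (boundaryTwo p A)) :
    homologyTwoMk p A x = 0 ↔ x.1 ∈ LinearMap.range (boundaryThree p A) := by
  have hx : x.1 ∈ cycles₂ (Rep.trivial (Fp.{u} p) A (Fp.{u} p)) := by
    rw [cycles₂, d₂₁_trivial_eq]
    exact x.2
  have h := H2π_eq_zero_iff (A := Rep.trivial (Fp.{u} p) A (Fp.{u} p)) ⟨x.1, hx⟩
  rw [boundaries₂, d₃₂_trivial_eq] at h
  exact h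

theorem exists_homologyMap_homologyTwoMk (f : A →* B) (x : LinearMap.ker (boundaryTwo p A)) :
    ∃ y : LinearMap.ker (boundaryTwo p B), y.1 = mapDomain (Prod.map f f) x.1 ∧
      homologyMap p f 2 (homologyTwoMk p A x) = homologyTwoMk p B y := by
  let x' : cycles₂ (Rep.trivial (Fp.{u} p) A (Fp.{u} p)) :=
    ⟨x.1, by rw [cycles₂, d₂₁_trivial_eq]; exact x.2⟩
  let φ : Rep.trivial (Fp.{u} p) A (Fp.{u} p) ⟶ Rep.res f (Rep.trivial (Fp.{u} p) B (Fp.{u} p)) :=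
    CategoryTheory.CategoryStruct.id (Rep.trivial (Fp.{u} p) A (Fp.{u} p))
  have h : (mapCycles₂ f φ x').1 = mapDomain (Prod.map f f) x.1 := Finsupp.mapRange_id _
  refine ⟨⟨_, ?_⟩, h, ?_⟩
  · rw [← d₂₁_trivial_eq]
    exact (mapCycles₂ f φ x').2
  · exact H2π_comp_map_apply (A := Rep.trivial (Fp.{u} p) A (Fp.{u} p))
      (B := Rep.trivial (Fp.{u} p) B (Fp.{u} p)) f φ x'

end Bridge

/-! ### Duality between homology and cocycles over a field. -/

theorem exists_dual_comp_eq {k V W : Type*} [Field k] [AddCommGroup V] [Module k V]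
    [AddCommGroup W] [Module k W] (π : V →ₗ[k] W) (μ : V →ₗ[k] k)
    (h : LinearMap.ker π ≤ LinearMap.ker μ) : ∃ l : W →ₗ[k] k, ∀ x, l (π x) = μ x := by
  have hμ : μ ∈ LinearMap.range π.dualMap := by
    rw [LinearMap.range_dualMap_eq_dualAnnihilator_ker, Submodule.mem_dualAnnihilator]
    exact fun x hx => h hx
  obtain ⟨l, rfl⟩ := hμ
  exact ⟨l, fun _ => rfl⟩

theorem exists_dual_eq_of_submodule {k V W : Type*} [Field k] [AddCommGroup V] [Module k V]
    [AddCommGroup W] [Module k W] (S : Submodule k V) (π : S →ₗ[k] W) (μ : V →ₗ[k] k)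
    (h : ∀ x, π x = 0 → μ x = 0) : ∃ l : W →ₗ[k] k, ∀ x, l (π x) = μ x :=
  exists_dual_comp_eq π (μ ∘ₗ S.subtype) fun x hx => h x hx

section Duality

variable {p : ℕ} {A B : Type u} [Group A] [Group B]

/-- Inhomogeneous `2`-cocycles with trivial coefficients `ℤ/p`. -/
def IsTwoCocycle (c : A → A → Fp.{u} p) : Prop :=
  ∀ x y z, c y z - c (x * y) z + c x (y * z) - c x y = 0

/-- Inhomogeneous `2`-coboundaries with trivial coefficients `ℤ/p`. -/
def IsTwoCoboundary (c : A → A → Fp.{u} p) : Prop :=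
  ∃ γ : A → Fp.{u} p, ∀ x y, c x y = γ y - γ (x * y) + γ x

/-- Restriction of the `2`-cochain `c` along `f`. -/
def cochainComap (f : A →* B) (c : B → B → Fp.{u} p) (x y : A) : Fp.{u} p := c (f x) (f y)

/-- Evaluation of a `2`-cochain on `2`-chains. -/
noncomputable def cochainEval (c : A → A → Fp.{u} p) : (A × A →₀ Fp.{u} p) →ₗ[Fp.{u} p] Fp.{u} p :=
  linearCombination _ fun g => c g.1 g.2

theorem cochainEval_mapDomain (f : A →* B) (c : B → B → Fp.{u} p) (z : A × A →₀ Fp.{u} p) :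
    cochainEval c (mapDomain (Prod.map f f) z) = cochainEval (cochainComap f c) z :=
  linearCombination_mapDomain _ _ _

theorem IsTwoCocycle.range_boundaryThree_le {c : A → A → Fp.{u} p} (hc : IsTwoCocycle c) :
    LinearMap.range (boundaryThree p A) ≤ LinearMap.ker (cochainEval c) := by
  rw [LinearMap.range_le_ker_iff]
  refine Finsupp.lhom_ext' fun g => LinearMap.ext_ring ?_
  simpa [boundaryThree, cochainEval] using hc g.1 g.2.1 g.2.2

theorem IsTwoCoboundary.cochainEval_eq_zero {c : A → A → Fp.{u} p} (hc : IsTwoCoboundary c)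
    {z : A × A →₀ Fp.{u} p} (hz : z ∈ LinearMap.ker (boundaryTwo p A)) : cochainEval c z = 0 := by
  obtain ⟨γ, hγ⟩ := hc
  have h : cochainEval c = linearCombination (Fp.{u} p) γ ∘ₗ boundaryTwo p A := by
    refine Finsupp.lhom_ext' fun g => LinearMap.ext_ring ?_
    simpa [boundaryTwo, cochainEval] using hγ g.1 g.2
  rw [h, LinearMap.comp_apply, LinearMap.mem_ker.1 hz, map_zero]

theorem single_mul_mem_range_boundaryTwo (a b : A) :
    single b 1 - single (a * b) 1 + single a 1 ∈ LinearMap.range (boundaryTwo p A) :=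
  ⟨single (a, b) 1, by simp [boundaryTwo]⟩

theorem dual_homologyOneMk_mul (l : Homology p A 1 →ₗ[Fp.{u} p] Fp.{u} p) (a b : A) :
    l (homologyOneMk p A (single (a * b) 1)) =
      l (homologyOneMk p A (single a 1)) + l (homologyOneMk p A (single b 1)) := by
  have h := (homologyOneMk_eq_zero_iff (p := p) _).2 (single_mul_mem_range_boundaryTwo a b)
  have h' := congrArg l h
  rw [map_add, map_sub, map_add, map_sub, map_zero] at h'
  linear_combination -h'

theorem homologyMap_one_surjective (f : A →* B) (hf : Function.Surjective f) :
    Function.Surjective (homologyMap p f 1) := by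
  intro y
  obtain ⟨y, rfl⟩ := homologyOneMk_surjective y
  obtain ⟨x, rfl⟩ := mapDomain_surjective hf y
  exact ⟨homologyOneMk p A x, homologyMap_homologyOneMk f x⟩

variable [Fact p.Prime]

/-- Vanishing on cycles lets the evaluation factor through `boundaryTwo`; the factor, a functional
on 1-chains, is the required 1-cochain. -/
theorem isTwoCoboundary_of_cochainEval_eq_zero {c : A → A → Fp.{u} p}
    (h : ∀ z ∈ LinearMap.ker (boundaryTwo p A), cochainEval c z = 0) : IsTwoCoboundary c := by
  obtain ⟨l, hl⟩ := exists_dual_comp_eq (boundaryTwo p A) (cochainEval c) h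
  refine ⟨fun x => l (single x 1), fun x y => ?_⟩
  have := hl (single (x, y) 1)
  simp only [boundaryTwo, cochainEval, linearCombination_single, one_smul, map_add, map_sub] at this
  exact this.symm

theorem exists_dual_homologyOne (φ : A → Fp.{u} p) (hφ : ∀ a b, φ (a * b) = φ a + φ b) :
    ∃ l : Homology p A 1 →ₗ[Fp.{u} p] Fp.{u} p, ∀ a, l (homologyOneMk p A (single a 1)) = φ a := by
  obtain ⟨l, hl⟩ := exists_dual_comp_eq (homologyOneMk p A) (linearCombination (Fp.{u} p) φ) <| by
    intro x hx
    obtain ⟨y, rfl⟩ := (homologyOneMk_eq_zero_iff x).1 hx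
    rw [LinearMap.mem_ker, ← LinearMap.comp_apply]
    suffices h : linearCombination (Fp.{u} p) φ ∘ₗ boundaryTwo p A = 0 by rw [h]; rfl
    refine Finsupp.lhom_ext' fun g => LinearMap.ext_ring ?_
    simp [boundaryTwo, hφ]
  exact ⟨l, fun a => by rw [hl]; simp⟩

theorem exists_dual_homologyTwo {c : A → A → Fp.{u} p} (hc : IsTwoCocycle c) :
    ∃ l : Homology p A 2 →ₗ[Fp.{u} p] Fp.{u} p, ∀ z, l (homologyTwoMk p A z) = cochainEval c z := by
  refine exists_dual_eq_of_submodule (LinearMap.ker (boundaryTwo p A)) (homologyTwoMk p A)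
    (cochainEval c) fun x hx => ?_
  exact hc.range_boundaryThree_le ((homologyTwoMk_eq_zero_iff x).1 hx)

/-- A functional on cycles extends to all 2-chains; its vanishing on boundaries is the cocycle
identity. -/
theorem exists_twoCocycle_of_dual (l : Homology p A 2 →ₗ[Fp.{u} p] Fp.{u} p) :
    ∃ c : A → A → Fp.{u} p, IsTwoCocycle c ∧ ∀ z, l (homologyTwoMk p A z) = cochainEval c z := by
  obtain ⟨μ, hμ⟩ := (l ∘ₗ homologyTwoMk p A).exists_extend
  have hc : cochainEval (fun x y => μ (single (x, y) 1)) = μ := by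
    refine Finsupp.lhom_ext' fun g => LinearMap.ext_ring ?_
    simp [cochainEval]
  refine ⟨fun x y => μ (single (x, y) 1), fun x y z => ?_, fun z => ?_⟩
  · have hw : boundaryThree p A (single (x, y, z) 1) ∈ LinearMap.ker (boundaryTwo p A) := by
      simp only [boundaryThree, boundaryTwo, LinearMap.mem_ker, linearCombination_single, one_smul,
        map_add, map_sub, mul_assoc]
      abel
    have h := LinearMap.congr_fun hμ ⟨_, hw⟩
    have h0 := (homologyTwoMk_eq_zero_iff (p := p) ⟨_, hw⟩).2 ⟨_, rfl⟩
    rw [LinearMap.comp_apply, LinearMap.comp_apply, h0, map_zero] at h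
    simpa [boundaryThree] using h
  · rw [hc]
    exact (LinearMap.congr_fun hμ z).symm

theorem exists_extension_of_homologyMap_injective (f : A →* B)
    (hf : Function.Injective (homologyMap p f 1)) (φ : A → Fp.{u} p)
    (hφ : ∀ a b, φ (a * b) = φ a + φ b) :
    ∃ ψ : B → Fp.{u} p, (∀ a b, ψ (a * b) = ψ a + ψ b) ∧ ∀ a, ψ (f a) = φ a := by
  obtain ⟨l, hl⟩ := exists_dual_homologyOne φ hφ
  obtain ⟨m, hm⟩ := exists_dual_comp_eq (homologyMap p f 1) l <| by
    rw [LinearMap.ker_eq_bot.2 hf]; exact bot_le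
  refine ⟨fun b => m (homologyOneMk p B (single b 1)), dual_homologyOneMk_mul m, fun a => ?_⟩
  rw [← hl, ← hm, homologyMap_homologyOneMk, mapDomain_single]

theorem homologyMap_injective_of_exists_extension (f : A →* B)
    (hf : ∀ φ : A → Fp.{u} p, (∀ a b, φ (a * b) = φ a + φ b) →
      ∃ ψ : B → Fp.{u} p, (∀ a b, ψ (a * b) = ψ a + ψ b) ∧ ∀ a, ψ (f a) = φ a) :
    Function.Injective (homologyMap p f 1) := by
  rw [injective_iff_map_eq_zero]
  intro x hx
  rw [← Module.forall_dual_apply_eq_zero_iff (Fp.{u} p)]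
  intro l
  obtain ⟨ψ, hψ, hψf⟩ := hf (fun a => l (homologyOneMk p A (single a 1))) (dual_homologyOneMk_mul l)
  obtain ⟨m, hm⟩ := exists_dual_homologyOne ψ hψ
  have h : (m ∘ₗ homologyMap p f 1) ∘ₗ homologyOneMk p A = l ∘ₗ homologyOneMk p A := by
    refine Finsupp.lhom_ext' fun a => LinearMap.ext_ring ?_
    simp only [LinearMap.comp_apply, lsingle_apply, homologyMap_homologyOneMk, mapDomain_single,
      hm, hψf]
  obtain ⟨x, rfl⟩ := homologyOneMk_surjective x
  have h' := LinearMap.congr_fun h x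
  simp only [LinearMap.comp_apply, hx, map_zero] at h'
  exact h'.symm

theorem dual_homologyMap_eq_zero_iff (f : A →* B) {c : B → B → Fp.{u} p}
    {l : Homology p B 2 →ₗ[Fp.{u} p] Fp.{u} p}
    (hl : ∀ z, l (homologyTwoMk p B z) = cochainEval c z) :
    (∀ x, l (homologyMap p f 2 x) = 0) ↔ IsTwoCoboundary (cochainComap f c) := by
  have key : ∀ z, l (homologyMap p f 2 (homologyTwoMk p A z)) =
      cochainEval (cochainComap f c) z.1 := by
    intro z
    obtain ⟨y, hy, hyz⟩ := exists_homologyMap_homologyTwoMk f z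
    rw [hyz, hl, hy, cochainEval_mapDomain]
  constructor
  · intro h
    exact isTwoCoboundary_of_cochainEval_eq_zero fun z hz => by rw [← key ⟨z, hz⟩, h]
  · intro h x
    obtain ⟨z, rfl⟩ := homologyTwoMk_surjective x
    rw [key, h.cochainEval_eq_zero z.2]

theorem dual_eq_zero_iff {c : B → B → Fp.{u} p} {l : Homology p B 2 →ₗ[Fp.{u} p] Fp.{u} p}
    (hl : ∀ z, l (homologyTwoMk p B z) = cochainEval c z) : l = 0 ↔ IsTwoCoboundary c := by
  constructor
  · rintro rfl
    exact isTwoCoboundary_of_cochainEval_eq_zero fun z hz => (hl ⟨z, hz⟩).symm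
  · intro h
    refine LinearMap.ext fun x => ?_
    obtain ⟨z, rfl⟩ := homologyTwoMk_surjective x
    rw [hl, h.cochainEval_eq_zero z.2, LinearMap.zero_apply]

/-- The map induced by `f` on `H_2 / Φ⁽ⁿ⁾` is onto if and only if a `2`-cocycle of `B` whose
restrictions to `A` and to `B⁽ⁿ⁾` are coboundaries is itself a coboundary. -/
theorem homologyTwoQuotientMap_surjective_iff (f : A →* B) (n : ℕ) :
    Function.Surjective (homologyTwoQuotientMap p f n) ↔
      ∀ c : B → B → Fp.{u} p, IsTwoCocycle c → IsTwoCoboundary (cochainComap f c) →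
        IsTwoCoboundary (cochainComap (pDerived p B n).subtype c) → IsTwoCoboundary c := by
  constructor
  · intro hf c hc hA hN
    obtain ⟨l, hl⟩ := exists_dual_homologyTwo hc
    rw [← dual_eq_zero_iff hl]
    rw [← dual_homologyMap_eq_zero_iff f hl] at hA
    rw [← dual_homologyMap_eq_zero_iff _ hl] at hN
    refine LinearMap.ext fun x => ?_
    obtain ⟨y, hy⟩ := hf (Submodule.Quotient.mk x)
    obtain ⟨y, rfl⟩ := Submodule.Quotient.mk_surjective _ y
    obtain ⟨w, hw⟩ := (Submodule.Quotient.eq _).1 hy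
    have := hN w
    rw [hw, map_sub, hA, zero_sub, neg_eq_zero] at this
    exact this
  · intro h
    rw [← LinearMap.range_eq_top]
    by_contra hne
    -- A nonzero functional killing the image, pulled back to `H_2(B)`, gives a cocycle that is
    -- trivial on `A` and on `B⁽ⁿ⁾`.
    obtain ⟨l, hl0, hl⟩ := Submodule.exists_le_ker_of_lt_top _ (lt_top_iff_ne_top.2 hne)
    obtain ⟨c, hc, hlc⟩ := exists_twoCocycle_of_dual (l ∘ₗ (Phi p B n).mkQ)
    have h0 := (dual_eq_zero_iff hlc).2 (h c hc
      ((dual_homologyMap_eq_zero_iff f hlc).1 fun x => hl ⟨Submodule.Quotient.mk x, rfl⟩)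
      ((dual_homologyMap_eq_zero_iff _ hlc).1 fun x => by
        have hx : (Phi p B n).mkQ (homologyMap p (pDerived p B n).subtype 2 x) = 0 :=
          (Submodule.Quotient.mk_eq_zero _).2 ⟨x, rfl⟩
        rw [LinearMap.comp_apply, hx, map_zero]))
    refine hl0 (LinearMap.ext fun x => ?_)
    obtain ⟨x, rfl⟩ := Submodule.Quotient.mk_surjective _ x
    exact LinearMap.congr_fun h0 x

end Duality

theorem prime_nsmul_eq_zero {p : ℕ} (k : Type*) [Semiring k] [CharP k p] {V : Type*}
    [AddCommMonoid V] [Module k V] (v : V) : p • v = 0 := by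
  rw [← Nat.cast_smul_eq_nsmul k, CharP.cast_eq_zero, zero_smul]

/-! ### Extending crossed homomorphisms along `f`. -/

section CrossedHom

variable {k : Type*} [Field k] {p : ℕ} [Fact p.Prime]

/-- Orbit counting: `p` divides `|V|`, so the fixed point `0` of the `p`-group is not the only one.
-/
theorem exists_fixed_vector [Finite k] [CharP k p] {B V : Type*} [Group B] [AddCommGroup V]
    [Module k V] [Module.Finite k V] [Nontrivial V] (ρ : Representation k B V) (N : Subgroup B)
    [N.Normal] (hN : N ≤ ρ.ker) (hP : IsPGroup p (B ⧸ N)) : ∃ z : V, z ≠ 0 ∧ ∀ b, ρ b z = z := by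
  let σ : B ⧸ N →* Module.End k V := QuotientGroup.lift N ρ hN
  let : MulAction (B ⧸ N) V := MulAction.compHom V σ
  have hsmul : ∀ (b : B) (v : V), (b : B ⧸ N) • v = ρ b v := fun _ _ => rfl
  have : Finite V := Module.finite_of_finite k
  have hp : p ∣ Nat.card V := by
    obtain ⟨v, hv⟩ := exists_ne (0 : V)
    have hv' : addOrderOf v = p := addOrderOf_eq_prime (prime_nsmul_eq_zero k v) hv
    exact hv' ▸ addOrderOf_dvd_natCard v
  have h0 : (0 : V) ∈ MulAction.fixedPoints (B ⧸ N) V := by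
    intro g
    obtain ⟨b, rfl⟩ := QuotientGroup.mk_surjective g
    rw [hsmul, map_zero]
  obtain ⟨z, hz, hz0⟩ := hP.exists_fixed_point_of_prime_dvd_card_of_fixed_point V hp h0
  exact ⟨z, hz0.symm, fun b => hz b⟩

/-- If homomorphisms to `k` extend along `f : A → B` and a `2`-cocycle of `B` vanishing on `N` is a
coboundary as soon as its restriction to `A` is one, then every crossed homomorphism on `A` with
values in a finite representation of the `p`-group `B ⧸ N` extends to `B`, up to a principal one. -/
theorem exists_crossedHom_extension [Finite k] [CharP k p] {A B : Type*} [Group A] [Group B]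
    (f : A →* B) (N : Subgroup B) [N.Normal] (hP : IsPGroup p (B ⧸ N))
    (h1 : ∀ φ : A → k, (∀ a b, φ (a * b) = φ a + φ b) →
      ∃ ψ : B → k, (∀ a b, ψ (a * b) = ψ a + ψ b) ∧ ∀ a, ψ (f a) = φ a)
    (h2 : ∀ c : B → B → k, (∀ x y z, c y z - c (x * y) z + c x (y * z) - c x y = 0) →
      (∀ x ∈ N, ∀ y ∈ N, c x y = 0) →
      (∃ α : A → k, ∀ x y, c (f x) (f y) = α y - α (x * y) + α x) →
      ∃ γ : B → k, ∀ x y, c x y = γ y - γ (x * y) + γ x)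
    {V : Type*} [AddCommGroup V] [Module k V] [Module.Finite k V] (ρ : Representation k B V)
    (hN : N ≤ ρ.ker) (d : A → V) (hd : ∀ a b, d (a * b) = d a + ρ (f a) (d b)) :
    ∃ (D : B → V) (m : V), (∀ x y, D (x * y) = D x + ρ x (D y)) ∧
      ∀ a, D (f a) = d a + ρ (f a) m - m := by
  induction hn : Module.finrank k V using Nat.strong_induction_on generalizing V with
  | _ n ih =>
  rcases subsingleton_or_nontrivial V with hV | hV
  · exact ⟨0, 0, fun _ _ => Subsingleton.elim _ _, fun _ => Subsingleton.elim _ _⟩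
  obtain ⟨z, hz0, hz⟩ := exists_fixed_vector ρ N hN hP
  have hinj : Function.Injective fun t : k => t • z := smul_left_injective k hz0
  -- Dévissage: solve the problem modulo the fixed line `W`, then correct the lift by scalars.
  let W : Submodule k V := k ∙ z
  have hW : ∀ b, W ≤ W.comap (ρ b) := by
    intro b
    rw [Submodule.span_singleton_le_iff_mem, Submodule.mem_comap, hz]
    exact Submodule.mem_span_singleton_self z
  let ρ' : Representation k B (V ⧸ W) := ρ.quotient W hW
  have hρ' : ∀ b v, ρ' b (W.mkQ v) = W.mkQ (ρ b v) := fun _ _ => rfl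
  have hN' : N ≤ ρ'.ker := by
    intro b hb
    refine LinearMap.ext fun v => ?_
    obtain ⟨v, rfl⟩ := W.mkQ_surjective v
    rw [hρ', show ρ b = 1 from hN hb]
    rfl
  have hlt : Module.finrank k (V ⧸ W) < n := by
    have h := W.finrank_quotient_add_finrank
    rw [finrank_span_singleton hz0] at h
    omega
  obtain ⟨D', m', hD', hm'⟩ := ih _ hlt ρ' hN' (fun a => W.mkQ (d a))
    (fun a b => by rw [hd, map_add, hρ']) rfl
  obtain ⟨s, hs⟩ := W.mkQ.exists_rightInverse_of_surjective
    (LinearMap.range_eq_top.2 W.mkQ_surjective)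
  replace hs : ∀ v, W.mkQ (s v) = v := LinearMap.congr_fun hs
  have hmem : ∀ v, W.mkQ v = 0 → ∃ t : k, t • z = v := fun v hv =>
    Submodule.mem_span_singleton.1 ((Submodule.Quotient.mk_eq_zero W).1 hv)
  have hρmul : ∀ x y v, ρ (x * y) v = ρ x (ρ y v) := fun x y v => by rw [map_mul]; rfl
  -- `c` is the obstruction to the lift `s ∘ D'` being a crossed homomorphism. On `A` it is the
  -- coboundary of `-α`, since `s ∘ D' ∘ f` differs from the crossed homomorphism `E` by `α`.
  have hc : ∀ x y, ∃ t : k, t • z = s (D' x) + ρ x (s (D' y)) - s (D' (x * y)) := by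
    intro x y
    refine hmem _ ?_
    rw [map_sub, map_add, ← hρ', hs, hs, hs, hD', sub_self]
  choose c hc using hc
  let E : A → V := fun a => d a + ρ (f a) (s m') - s m'
  have hE : ∀ a b, E (a * b) = E a + ρ (f a) (E b) := by
    intro a b
    simp only [E, hd, map_mul, map_add, map_sub, Module.End.mul_apply]
    abel
  have hα : ∀ a, ∃ t : k, t • z = E a - s (D' (f a)) := by
    intro a
    refine hmem _ ?_
    simp only [E]
    rw [map_sub, map_sub, map_add, ← hρ', hs, hs, hm', sub_self]
  choose α hα using hα
  have hcf : ∀ a b, c (f a) (f b) = -α b - -α (a * b) + -α a := by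
    intro a b
    apply hinj
    have h1 := congrArg (ρ (f a)) (hα b)
    rw [map_smul, hz, map_sub] at h1
    simp only [add_smul, sub_smul, neg_smul, hc, h1, hα, hE, ← map_mul]
    abel
  obtain ⟨γ, hγ⟩ := h2 c (fun x y w => by
      apply hinj
      have h1 := congrArg (ρ x) (hc y w)
      rw [map_smul, hz] at h1
      simp only [add_smul, sub_smul, zero_smul, hc (x * y), hc x, h1, map_add, map_sub, hρmul,
        mul_assoc]
      abel)
    -- On `N` the action is trivial, so `D'` is additive there; linearity of the section `s` makes
    -- `c` vanish exactly.
    (fun x hx y hy => by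
      apply hinj
      have hx1 : ρ x = 1 := hN hx
      have hx1' : ρ' x = 1 := hN' hx
      simp only [zero_smul, hc, hD', hx1, hx1', Module.End.one_apply, map_add, sub_self])
    ⟨fun a => -α a, hcf⟩
  -- Both `-α` and `γ ∘ f` have coboundary `c ∘ f`, so they differ by a homomorphism, which extends
  -- to `B`.
  obtain ⟨ψ, hψ, hψf⟩ := h1 (fun a => α a + γ (f a)) (fun a b => by
    have h := hcf a b
    rw [hγ, ← map_mul] at h
    linear_combination -h)
  refine ⟨fun x => s (D' x) - γ x • z + ψ x • z, s m', fun x y => ?_, fun a => ?_⟩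
  · have h := hc x y
    rw [hγ] at h
    have h' : s (D' (x * y)) =
        s (D' x) + ρ x (s (D' y)) - (γ y - γ (x * y) + γ x) • z := by rw [h]; abel
    simp only [h', hψ, map_add, map_sub, map_smul, hz, add_smul, sub_smul]
    abel
  · have h := hα a
    simp only [hψf, add_smul, h]
    simp only [E]
    abel

end CrossedHom

theorem fg_of_isFinitelyPresented {G : Type*} [Group G] (h : Group.IsFinitelyPresented G) :
    Group.FG G := by
  obtain ⟨n, φ, hφ, -⟩ := h.out
  exact Group.fg_of_surjective hφ

theorem exists_addMonoidHom_ne_zero (k : Type*) [Field k] {V : Type*} [AddCommGroup V] [Module k V]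
    {v : V} (hv : v ≠ 0) : ∃ l : V →+ k, l v ≠ 0 := by
  by_contra! hl
  exact hv ((Module.forall_dual_apply_eq_zero_iff k v).1 fun l => hl l.toAddMonoidHom)

/-! ### Structure of the `p`-derived series. -/

section PDerived

variable {p : ℕ} {A B : Type u} [Group A] [Group B]

instance (n : ℕ) : (pDerived p A n).Normal := pDerived_normal p A n

theorem pow_mem_pDerived_succ {n : ℕ} {x : A} (hx : x ∈ pDerived p A n) :
    x ^ p ∈ pDerived p A (n + 1) :=
  le_sup_left (a := Subgroup.closure _) (Subgroup.subset_closure ⟨x, hx, rfl⟩)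

theorem commutator_pDerived_le (n : ℕ) :
    ⁅pDerived p A n, pDerived p A n⁆ ≤ pDerived p A (n + 1) :=
  le_sup_right

theorem pDerived_antitone : Antitone (pDerived p A) :=
  antitone_nat_of_succ_le (pDerived_succ_le p A)

theorem isPGroup_quotient_pDerived (n : ℕ) : IsPGroup p (A ⧸ pDerived p A n) := by
  intro q
  obtain ⟨x, rfl⟩ := QuotientGroup.mk_surjective q
  refine ⟨n, ?_⟩
  rw [← QuotientGroup.mk_pow, QuotientGroup.eq_one_iff]
  induction n with
  | zero => exact Subgroup.mem_top _
  | succ n ih => rw [pow_succ, pow_mul]; exact pow_mem_pDerived_succ ih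

/-- A map additive on `A⁽ⁿ⁾` with values in an abelian group of exponent `p` kills `A⁽ⁿ⁺¹⁾`. -/
theorem eq_zero_of_mem_pDerived_succ {V : Type*} [AddCommGroup V] (hV : ∀ v : V, p • v = 0) {n : ℕ}
    (δ : A → V) (hδ : ∀ x ∈ pDerived p A n, ∀ y ∈ pDerived p A n, δ (x * y) = δ x + δ y) {x : A}
    (hx : x ∈ pDerived p A (n + 1)) : δ x = 0 := by
  let χ : pDerived p A n →* Multiplicative V :=
    MonoidHom.mk' (fun x => Multiplicative.ofAdd (δ x)) fun x y => hδ x x.2 y y.2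
  have hle : pDerived p A (n + 1) ≤ χ.ker.map (pDerived p A n).subtype := by
    refine sup_le ?_ ?_
    · rw [Subgroup.closure_le]
      rintro _ ⟨y, hy, rfl⟩
      refine ⟨⟨y, hy⟩ ^ p, ?_, rfl⟩
      rw [SetLike.mem_coe, MonoidHom.mem_ker, map_pow]
      exact hV (δ y)
    · rw [Subgroup.commutator_le]
      intro y hy z hz
      let y' : pDerived p A n := ⟨y, hy⟩
      let z' : pDerived p A n := ⟨z, hz⟩
      refine ⟨y' * z' * y'⁻¹ * z'⁻¹, ?_, rfl⟩
      rw [SetLike.mem_coe, MonoidHom.mem_ker]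
      simp only [map_mul, map_inv]
      rw [mul_inv_eq_one, mul_right_comm, mul_inv_cancel, one_mul]
  obtain ⟨y, hy, rfl⟩ := hle hx
  exact hy

/-- The quotient `A⁽ⁿ⁾ / A⁽ⁿ⁺¹⁾`. -/
abbrev PDerivedQuotient (p : ℕ) (A : Type u) [Group A] (n : ℕ) : Type u :=
  pDerived p A n ⧸ (pDerived p A (n + 1)).subgroupOf (pDerived p A n)

theorem PDerivedQuotient.mul_comm {n : ℕ} (x y : PDerivedQuotient p A n) : x * y = y * x := by
  obtain ⟨x, rfl⟩ := QuotientGroup.mk_surjective x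
  obtain ⟨y, rfl⟩ := QuotientGroup.mk_surjective y
  rw [← QuotientGroup.mk_mul, ← QuotientGroup.mk_mul, QuotientGroup.eq, Subgroup.mem_subgroupOf]
  have h := Subgroup.commutator_mem_commutator (inv_mem y.2) (inv_mem x.2)
  rw [commutatorElement_def, inv_inv, inv_inv] at h
  refine commutator_pDerived_le n ?_
  simpa [mul_assoc] using h

instance (n : ℕ) : CommGroup (PDerivedQuotient p A n) :=
  { (inferInstance : Group (PDerivedQuotient p A n)) with mul_comm := PDerivedQuotient.mul_comm }

theorem PDerivedQuotient.pow_eq_one {n : ℕ} (x : PDerivedQuotient p A n) : x ^ p = 1 := by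
  obtain ⟨x, rfl⟩ := QuotientGroup.mk_surjective x
  exact (QuotientGroup.eq_one_iff (x ^ p)).2 (pow_mem_pDerived_succ x.2)

variable [Fact p.Prime]

/-- The quotient `A⁽ⁿ⁾ / A⁽ⁿ⁺¹⁾` is a vector space over `ZMod p`, and functionals separate its
points. -/
theorem exists_hom_ne_zero {n : ℕ} {a : A} (ha : a ∈ pDerived p A n)
    (ha' : a ∉ pDerived p A (n + 1)) :
    ∃ φ : pDerived p A n → Fp.{u} p, (∀ x y, φ (x * y) = φ x + φ y) ∧ φ ⟨a, ha⟩ ≠ 0 := by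
  have h : ((⟨a, ha⟩ : pDerived p A n) : PDerivedQuotient p A n) ≠ 1 := fun h =>
    ha' ((QuotientGroup.eq_one_iff (⟨a, ha⟩ : pDerived p A n)).1 h)
  let _ : Module (ZMod p) (Additive (PDerivedQuotient p A n)) :=
    AddCommGroup.zmodModule fun x => PDerivedQuotient.pow_eq_one x.toMul
  obtain ⟨l, hl⟩ := exists_addMonoidHom_ne_zero (ZMod p)
    (V := Additive (PDerivedQuotient p A n)) (v := Additive.ofMul _) h
  exact ⟨fun x => ULift.up (l (Additive.ofMul (x : PDerivedQuotient p A n))),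
    fun x y => congrArg ULift.up (map_add l (Additive.ofMul (x : PDerivedQuotient p A n))
      (Additive.ofMul (y : PDerivedQuotient p A n))), fun h0 => hl (congrArg ULift.down h0)⟩

/-- A finite-index subgroup of a finitely generated group is finitely generated, so each successive
quotient is finitely generated, abelian and torsion, hence finite. -/
theorem finiteIndex_pDerived [Group.FG A] (n : ℕ) : (pDerived p A n).FiniteIndex := by
  induction n with
  | zero => exact (inferInstance : (⊤ : Subgroup A).FiniteIndex)
  | succ n ih =>
    have : Finite (PDerivedQuotient p A n) :=
      CommGroup.finite_of_fg_isMulTorsion _ fun x =>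
        isOfFinOrder_iff_pow_eq_one.2
          ⟨p, (Fact.out : p.Prime).pos, PDerivedQuotient.pow_eq_one x⟩
    have h : ((pDerived p A (n + 1)).subgroupOf (pDerived p A n)).index ≠ 0 :=
      Subgroup.index_ne_zero_of_finite
    refine ⟨?_⟩
    rw [← Subgroup.relIndex_mul_index (pDerived_succ_le p A n)]
    exact mul_ne_zero h ih.index_ne_zero

end PDerived

theorem chClass.chMonoClass {p n : ℕ} {A B : Type u} [Group A] [Group B] {f : A →* B}
    (h : chClass p n f) : chMonoClass p n f :=
  ⟨h.1, h.2.1, h.2.2.1.injective, h.2.2.2⟩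

/-! ### Shapiro's lemma and injectivity on the quotients by the series. -/

section Stability

variable {p : ℕ} [Fact p.Prime] {A B : Type u} [Group A] [Group B]

/-- The representation of `B` on functions on `B ⧸ N` by right translations. -/
def rightTranslation (k : Type*) [Field k] (N : Subgroup B) [N.Normal] :
    Representation k B (B ⧸ N → k) where
  toFun b := LinearMap.funLeft k k fun q => q * (b : B ⧸ N)
  map_one' := by
    ext
    simp [LinearMap.funLeft]
  map_mul' x y := by
    refine LinearMap.ext fun m => funext fun q => ?_
    simp [LinearMap.funLeft_apply, mul_assoc]

theorem rightTranslation_apply (k : Type*) [Field k] (N : Subgroup B) [N.Normal] (b : B)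
    (m : B ⧸ N → k) (q : B ⧸ N) : rightTranslation k N b m q = m (q * (b : B ⧸ N)) := rfl

/-- A homomorphism on a normal subgroup `N` extends to an `N`-equivariant function. -/
theorem exists_equivariant_extension {k : Type*} [Add k] (N : Subgroup A) [N.Normal] (φ : N → k)
    (hφ : ∀ x y, φ (x * y) = φ x + φ y) :
    ∃ Φ : A → k, ∀ (h : N) (g : A), Φ (h * g) = φ h + Φ g := by
  have hmem : ∀ g : A, g * ((g : A ⧸ N).out)⁻¹ ∈ N := by
    intro g
    rw [← QuotientGroup.eq_one_iff, QuotientGroup.mk_mul, QuotientGroup.mk_inv,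
      QuotientGroup.out_eq', mul_inv_cancel]
  refine ⟨fun g => φ ⟨_, hmem g⟩, fun h g => ?_⟩
  rw [← hφ]
  refine congrArg φ (Subtype.ext ?_)
  have : ((h * g : A) : A ⧸ N) = (g : A ⧸ N) := by
    rw [QuotientGroup.mk_mul, (QuotientGroup.eq_one_iff (h : A)).2 h.2, one_mul]
  simp only [this, Subgroup.coe_mul, mul_assoc]

/-- Shapiro's lemma in degree one: a homomorphism on `M = f⁻¹(N)` is induced by a crossed
homomorphism with values in the functions on `B ⧸ N`. -/
theorem exists_crossedHom_of_hom {k : Type*} [Field k] (f : A →* B) (M : Subgroup A) [M.Normal]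
    (N : Subgroup B) [N.Normal] (hMN : N.comap f ≤ M) (φ : M → k)
    (hφ : ∀ x y, φ (x * y) = φ x + φ y) :
    ∃ d : A → B ⧸ N → k, (∀ a b, d (a * b) = d a + rightTranslation k N (f a) (d b)) ∧
      ∀ a : M, d a 1 = φ a := by
  classical
  obtain ⟨Φ, hΦ⟩ := exists_equivariant_extension M φ hφ
  -- Changing `g` by an element of `M` shifts both values of `Φ` equally, so the choice is harmless.
  -- Extension by zero is consistent because right translation by `f a` preserves the image of `A`
  -- in `B ⧸ N`.
  let d : A → B ⧸ N → k := fun x q =>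
    if h : ∃ g, (f g : B ⧸ N) = q then Φ (h.choose * x) - Φ h.choose else 0
  have hd : ∀ x g, d x (f g : B ⧸ N) = Φ (g * x) - Φ g := by
    intro x g
    have h : ∃ g', (f g' : B ⧸ N) = (f g : B ⧸ N) := ⟨g, rfl⟩
    have hm : h.choose * g⁻¹ ∈ M := by
      apply hMN
      rw [Subgroup.mem_comap, ← QuotientGroup.eq_one_iff, map_mul, map_inv, QuotientGroup.mk_mul,
        QuotientGroup.mk_inv, h.choose_spec, mul_inv_cancel]
    have h1 := hΦ ⟨_, hm⟩ g
    have h2 := hΦ ⟨_, hm⟩ (g * x)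
    simp only [mul_assoc, inv_mul_cancel_left] at h1 h2
    simp only [d, dif_pos h, inv_mul_cancel, mul_one] at h1 h2 ⊢
    rw [h1, h2]
    ring
  have hd0 : ∀ x q, (¬ ∃ g, (f g : B ⧸ N) = q) → d x q = 0 := fun x q h => dif_neg h
  refine ⟨d, fun x y => funext fun q => ?_, fun a => ?_⟩
  · rw [Pi.add_apply, rightTranslation_apply]
    by_cases h : ∃ g, (f g : B ⧸ N) = q
    · obtain ⟨g, rfl⟩ := h
      rw [← QuotientGroup.mk_mul, ← map_mul, hd, hd, hd, mul_assoc]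
      ring
    · rw [hd0 _ _ h, hd0 _ _ h, hd0, add_zero]
      rintro ⟨g, hg⟩
      refine h ⟨g * x⁻¹, ?_⟩
      rw [map_mul, map_inv, QuotientGroup.mk_mul, QuotientGroup.mk_inv, hg, mul_inv_cancel_right]
  · have h1 := hd a 1
    rw [map_one, QuotientGroup.mk_one, one_mul] at h1
    have h2 := hΦ a 1
    rw [mul_one] at h2
    rw [h1, h2]
    ring

/-- If `f` is a monomorphism on `H_1(-; ℤ/p)` and an epimorphism on `H_2 / Φ⁽ⁿ⁾`, then it induces
monomorphisms `A / A⁽ᵏ⁾ → B / B⁽ᵏ⁾` for `k ≤ n + 1`. -/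
theorem comap_pDerived_le [Group.FG B] (f : A →* B) (n : ℕ)
    (hf1 : Function.Injective (homologyMap p f 1))
    (hf2 : Function.Surjective (homologyTwoQuotientMap p f n)) {k : ℕ} (hk : k ≤ n + 1) :
    (pDerived p B k).comap f ≤ pDerived p A k := by
  induction k with
  | zero => exact le_top
  | succ k ih =>
    intro a ha
    have haB : f a ∈ pDerived p B k := pDerived_succ_le p B k ha
    have haA : a ∈ pDerived p A k := ih (by omega) haB
    by_contra hne
    obtain ⟨φ, hφ, hφa⟩ := exists_hom_ne_zero haA hne
    obtain ⟨d, hd, hdφ⟩ := exists_crossedHom_of_hom f (pDerived p A k) (pDerived p B k)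
      (ih (by omega)) φ hφ
    have := finiteIndex_pDerived (p := p) (A := B) k
    let ρ := rightTranslation (Fp.{u} p) (pDerived p B k)
    have hρ : pDerived p B k ≤ ρ.ker := by
      intro b hb
      refine LinearMap.ext fun m => funext fun q => ?_
      rw [rightTranslation_apply, (QuotientGroup.eq_one_iff b).2 hb, mul_one]
      rfl
    obtain ⟨D, m, hD, hDf⟩ := exists_crossedHom_extension f (pDerived p B k)
      (isPGroup_quotient_pDerived k) (exists_extension_of_homologyMap_injective f hf1)
      (fun c hc hN hA => (homologyTwoQuotientMap_surjective_iff f n).1 hf2 c hc hA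
        -- The obstruction cocycle vanishes on `B⁽ᵏ⁾`, which contains `B⁽ⁿ⁾` because `k ≤ n`; the
        -- zero cochain therefore bounds its restriction.
        ⟨0, fun x y => by
          have hle : pDerived p B n ≤ pDerived p B k := pDerived_antitone (by omega)
          simpa using! hN _ (hle x.2) _ (hle y.2)⟩) ρ hρ d hd
    have h0 : D (f a) = 0 := eq_zero_of_mem_pDerived_succ
      (prime_nsmul_eq_zero (Fp.{u} p)) D
      (fun x hx y _ => by rw [hD, show ρ x = 1 from hρ hx]; rfl) ha
    -- The principal term vanishes because `f a` acts trivially, so `d a = 0`; its value at the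
    -- identity coset is `φ a`.
    rw [hDf, show ρ (f a) = 1 from hρ haB, Module.End.one_apply, add_sub_cancel_right] at h0
    refine hφa ?_
    rw [← hdφ ⟨a, haA⟩, h0]
    rfl

/-! ### The projection to a finite quotient belongs to the class. -/

theorem exists_factor_quotient {k : Type*} (N : Subgroup A) (h : A → k)
    (hN : ∀ g, ∀ x ∈ N, h (g * x) = h g) : ∃ ψ : A ⧸ N → k, ∀ g : A, ψ g = h g := by
  refine ⟨fun q => h q.out, fun g => ?_⟩
  obtain ⟨x, hx⟩ := QuotientGroup.mk_out_eq_mul N g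
  exact (congrArg h hx).trans (hN g x x.2)

theorem homologyMap_one_mk'_injective (n : ℕ) :
    Function.Injective (homologyMap p (QuotientGroup.mk' (pDerived p A (n + 1))) 1) := by
  refine homologyMap_injective_of_exists_extension _ fun φ hφ => ?_
  obtain ⟨ψ, hψ⟩ := exists_factor_quotient (pDerived p A (n + 1)) φ fun g x hx => by
    have h0 : φ x = 0 := eq_zero_of_mem_pDerived_succ (p := p) (n := 0)
      (prime_nsmul_eq_zero (Fp.{u} p)) φ (fun x _ y _ => hφ x y) (pDerived_antitone (by omega) hx)
    rw [hφ, h0, add_zero]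
  refine ⟨ψ, fun x y => ?_, hψ⟩
  obtain ⟨x, rfl⟩ := QuotientGroup.mk_surjective x
  obtain ⟨y, rfl⟩ := QuotientGroup.mk_surjective y
  rw [← QuotientGroup.mk_mul, hψ, hψ, hψ, hφ]

/-- If `α` bounds the cocycle on `A` and `β` bounds it on the `n`-th term of the quotient, then `α -
β ∘ π` is additive on `A⁽ⁿ⁾`, so it dies on `A⁽ⁿ⁺¹⁾`. This makes `α` invariant under `A⁽ⁿ⁺¹⁾`, and
it descends to bound the cocycle. -/
theorem homologyTwoQuotientMap_mk'_surjective (n : ℕ) :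
    Function.Surjective
      (homologyTwoQuotientMap p (QuotientGroup.mk' (pDerived p A (n + 1))) n) := by
  rw [homologyTwoQuotientMap_surjective_iff]
  rintro c hc ⟨α, hα⟩ ⟨β, hβ⟩
  let π := QuotientGroup.mk' (pDerived p A (n + 1))
  replace hα : ∀ x y, c (π x) (π y) = α y - α (x * y) + α x := hα
  have hπ : ∀ x ∈ pDerived p A (n + 1), π x = 1 := fun x hx => (QuotientGroup.eq_one_iff x).2 hx
  have hmem : ∀ x ∈ pDerived p A n, π x ∈ pDerived p (A ⧸ pDerived p A (n + 1)) n :=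
    fun x hx => map_pDerived_le p π n ⟨x, hx, rfl⟩
  classical
  let β' : A ⧸ pDerived p A (n + 1) → Fp.{u} p := fun q =>
    if h : q ∈ pDerived p (A ⧸ pDerived p A (n + 1)) n then β ⟨q, h⟩ else 0
  have hβ' : ∀ x ∈ pDerived p A n, ∀ y ∈ pDerived p A n,
      c (π x) (π y) = β' (π y) - β' (π x * π y) + β' (π x) := by
    intro x hx y hy
    simp only [β', dif_pos (hmem x hx), dif_pos (hmem y hy),
      dif_pos (mul_mem (hmem x hx) (hmem y hy))]
    exact hβ ⟨_, hmem x hx⟩ ⟨_, hmem y hy⟩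
  have hαβ : ∀ x ∈ pDerived p A (n + 1), α x = β' 1 := by
    intro x hx
    have h := eq_zero_of_mem_pDerived_succ (prime_nsmul_eq_zero (Fp.{u} p))
      (fun x => α x - β' (π x)) (fun x hx y hy => by
        have h := hβ' x hx y hy
        rw [hα, ← map_mul] at h
        linear_combination -h) hx
    simp only [hπ x hx] at h
    linear_combination h
  -- The cocycle is not normalised, so its constant value at `(q, 1)` has to be matched with that of
  -- `α` on `A⁽ⁿ⁺¹⁾`.
  have hc1 : ∀ q, c q 1 = β' 1 := by
    intro q
    have h1 := hc q 1 1
    have h2 := hβ' 1 (one_mem _) 1 (one_mem _)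
    simp only [map_one, mul_one] at h1 h2
    linear_combination h2 - h1
  obtain ⟨γ, hγ⟩ := exists_factor_quotient (pDerived p A (n + 1)) α fun g x hx => by
    have h := hα g x
    rw [hπ x hx, hc1, hαβ x hx] at h
    linear_combination h
  refine ⟨γ, fun x y => ?_⟩
  obtain ⟨x, rfl⟩ := QuotientGroup.mk_surjective x
  obtain ⟨y, rfl⟩ := QuotientGroup.mk_surjective y
  rw [← QuotientGroup.mk_mul, hγ, hγ, hγ]
  exact hα x y

/-- Finite groups are finitely presented. The index `n - 1 + 1` is `n`, except that it is `1` when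
`n = 0`. -/
theorem chClass_mk' [Group.FG A] (n : ℕ) :
    chClass p n (QuotientGroup.mk' (pDerived p A (n - 1 + 1))) := by
  have := finiteIndex_pDerived (p := p) (A := A) (n - 1 + 1)
  exact ⟨‹_›, inferInstance, ⟨homologyMap_one_mk'_injective _,
    homologyMap_one_surjective _ (QuotientGroup.mk'_surjective _)⟩,
    homologyTwoQuotientMap_mk'_surjective _⟩

/-- Enlarging the class enlarges the stabilization, so the upper bound is needed only for the large
class and the lower bound only for the small one. -/
theorem isStableSeries_of_le_chMonoClass {H : ℕ → MapClass.{u}}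
    (hle : ∀ (n : ℕ) (A B : Type u) [Group A] [Group B] (f : A →* B),
      H n f → chMonoClass p n f)
    (hge : ∀ (n : ℕ) (A B : Type u) [Group A] [Group B] (f : A →* B),
      chClass p n f → H n f) :
    IsStableSeries.{u} (fun A _ => Group.FG A) (pDerivedSeries p) H := by
  refine fun n => ⟨fun A B _ _ f _ => map_pDerived_le p f n, fun A _ hA => ?_⟩
  apply Set.Subset.antisymm
  · rintro a ⟨B, _, f, hf, ha⟩
    obtain ⟨-, hB, h1, h2⟩ := hle n A B f hf
    have := fg_of_isFinitelyPresented hB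
    exact comap_pDerived_le f (n - 1) h1 h2 (by omega) ha
  · intro a ha
    exact ⟨_, inferInstance, _, hge n _ _ _ (chClass_mk' n), map_pDerived_le p _ n ⟨a, ha, rfl⟩⟩

end Stability

end StableSeries

theorem proposition4p3 (p : ℕ) [Fact p.Prime] :
    StableSeries.IsStableSeries.{u} (fun A _ => Group.FG A)
        (StableSeries.pDerivedSeries p) (StableSeries.chClass p) ∧
      StableSeries.IsStableSeries.{u} (fun A _ => Group.FG A)
        (StableSeries.pDerivedSeries p) (StableSeries.chMonoClass p) :=
  ⟨StableSeries.isStableSeries_of_le_chMonoClass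
      (fun _ _ _ _ _ _ h => h.chMonoClass) (fun _ _ _ _ _ _ h => h),
    StableSeries.isStableSeries_of_le_chMonoClass
      (fun _ _ _ _ _ _ h => h) (fun _ _ _ _ _ _ h => h.chMonoClass)⟩
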